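/- For an integer $d\ge 0$ let $M_d(t)=\binom{t+d}{d}+\binom{t}{d}$, a polynomial in $t$ with complex coefficients, where $\binom{t+a}{d}=\frac{(t+a)(t+a-1)\cdots(t+a-d+1)}{d!}$. A nonzero polynomial $f$ of degree $d$ is called *Stanley non-negative* (SNN) if $\sum_{t\ge 0}f(t)x^t=\frac{\sum_{j=0}^d h_j^*x^j}{(1-x)^{d+1}}$ with real $h_0^*,\dots,h_d^*\ge 0$. An *Ehrhart polynomial* is a polynomial $f$ for which there is a nonempty lattice polytope $P\subset\mathbb{R}^n$ (the convex hull of finitely many points of $\mathbb{Z}^n$, for some $n$, not necessarily full-dimensional) such that $f(t)=\#(tP\cap\mathbb{Z}^n)$ for all integers $t\ge 0$. **Theorem.** 1. $M_d$ is SNN for every $d\geq 0$. 2. For every integer $d\ge 0$ with $d\neq 1$, $M_d$ is not an Ehrhart polynomial. (For $d=1$, $M_1(t)=2t+1$ is the Ehrhart polynomial of the segment $[0,2]$.) 3. For every $d\geq 0$, every complex root of $M_d$ has real part $-\frac12$. 4. For every $d\ge 1$ the equation $\sum_{j=0}^{d-1}\operatorname{arccot}\left(\frac{b}{j+1/2}\right)=\frac{\pi}{2}$,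 with $\operatorname{arccot}$ taking values in $(0,\pi)$, has exactly one real solution $b=b_d$; moreover $b_d\ge 0$, and the roots of $M_d$ of maximal norm are exactly $-\frac12\pm i\,b_d$. 5. If, for every $d\ge 1$, $\beta_d$ is a root of $M_d$ of maximal norm, then $\left|\beta_d+\frac12\right|=\frac{d^2}{\pi}+O(1)$ as $d\to\infty$. -/

import Mathlib

open scoped Pointwise Nat Topology
open Filter Asymptotics

noncomputable section

namespace SNNRoots

/-- The polynomial `C(t + a, d) = (t + a)(t + a - 1) ⋯ (t + a - d + 1) / d!` in the variable `t`,
with complex coefficients. -/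
def binomPoly (a d : ℕ) : Polynomial ℂ :=
  Polynomial.C ((d ! : ℂ)⁻¹) *
    (descPochhammer ℂ d).comp (Polynomial.X + Polynomial.C (a : ℂ))

/-- The polynomial `M_d(t) = C(t + d, d) + C(t, d)`. -/
def M (d : ℕ) : Polynomial ℂ :=
  binomPoly d d + binomPoly 0 d

/-- A nonzero polynomial `f` of degree `d` is Stanley non-negative if
`∑_{t ≥ 0} f(t) x ^ t = (∑_{j = 0}^{d} h_j x ^ j) / (1 - x) ^ (d + 1)` with real numbers
`h_0, …, h_d ≥ 0`; the identity of formal power series is written with the denominator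
cleared. -/
def IsSNN (f : Polynomial ℂ) : Prop :=
  f ≠ 0 ∧ ∃ h : ℕ → ℝ, (∀ j, 0 ≤ h j) ∧
    PowerSeries.mk (fun t : ℕ => f.eval (t : ℂ)) *
        (1 - (PowerSeries.X : PowerSeries ℂ)) ^ (f.natDegree + 1) =
      ∑ j ∈ Finset.range (f.natDegree + 1),
        PowerSeries.C (h j : ℂ) * (PowerSeries.X : PowerSeries ℂ) ^ j

/-- The inclusion of `ℤⁿ` into `ℝⁿ`. -/
def latticePoint {n : ℕ} (z : Fin n → ℤ) : Fin n → ℝ := fun i => (z i : ℝ)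

/-- A lattice polytope in `ℝⁿ`: the convex hull of a finite nonempty set of points of `ℤⁿ`.
Its affine span may have any dimension. -/
def IsLatticePolytope {n : ℕ} (P : Set (Fin n → ℝ)) : Prop :=
  ∃ V : Finset (Fin n → ℤ), V.Nonempty ∧
    P = convexHull ℝ (latticePoint '' (V : Set (Fin n → ℤ)))

/-- The number of lattice points in the dilate `t • P`. -/
def latticeCount {n : ℕ} (P : Set (Fin n → ℝ)) (t : ℕ) : ℕ :=
  Set.ncard {z : Fin n → ℤ | latticePoint z ∈ (t : ℝ) • P}

/-- `f` is the Ehrhart polynomial of some lattice polytope (in some `ℝⁿ`). -/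
def IsEhrhart (f : Polynomial ℂ) : Prop :=
  ∃ (n : ℕ) (P : Set (Fin n → ℝ)), IsLatticePolytope P ∧
    ∀ t : ℕ, f.eval (t : ℂ) = (latticeCount P t : ℂ)

/-- `β` is a root of `f` of maximal norm among all complex roots of `f`. -/
def IsMaxNormRoot (f : Polynomial ℂ) (β : ℂ) : Prop :=
  f.IsRoot β ∧ ∀ s : ℂ, f.IsRoot s → ‖s‖ ≤ ‖β‖

/-- The inverse cotangent with values in `(0, π)`. -/
def arccot (x : ℝ) : ℝ := Real.pi / 2 - Real.arctan x

/-- `p_d(b) = ∑_{j = 0}^{d - 1} arccot (b / (j + 1/2))`. -/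
def arccotSum (d : ℕ) (b : ℝ) : ℝ :=
  ∑ j ∈ Finset.range d, arccot (b / ((j : ℝ) + 1 / 2))

end SNNRoots

end

namespace SNNRoots

/-! ### Values, degree and Stanley non-negativity of `M d` -/

/-! The generating series of `C(t + d, d)` is `1 / (1 - x) ^ (d + 1)`, so `M d` has numerator `1 + x
^ d`, which gives SNN.

Roots: centred at `-1/2`, `M d` is up to a constant `∏ (s + (j + 1/2)) + ∏ (s - (j + 1/2))`. Off the
imaginary axis one product strictly dominates in norm, so every root has `s = i b`. There the
factors have opposite phases `∓ arccot (b / (j + 1/2))`, and the sum is a nonzero multiple of `cos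
(p_d(b))` (`isRoot_M_iff`). Since `p_d` is nonnegative and strictly decreasing, the extreme root is
where `p_d` equals the first zero `π / 2` of the cosine. The bounds `x - x ^ 3 / 3 ≤ arctan x ≤ x`
give `p_d(b) = d ^ 2 / (2 b) + O(d ^ 4 / b ^ 3)`, hence the asymptotics.

Not Ehrhart, `d ≥ 2`: the count at `t = 1` says that `P` has exactly `d + 1` lattice points, and
these span `P`. If they are affinely dependent, the counts are `O(t ^ (d - 1))`, too small.
Otherwise `P` is a simplex whose dilates below `d` contain only sums of vertices; then so does the
`d`-th (`LatticeAffineIndependent.dilatePoints_subset_sumPoints`), which leaves no room for the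
extra `C(d, d) = 1` point. -/

theorem eval_binomPoly (a d : ℕ) (s : ℂ) :
    (binomPoly a d).eval s = (d ! : ℂ)⁻¹ * ∏ j ∈ Finset.range d, (s + a - j) := by
  simp [binomPoly, descPochhammer_eval_eq_prod_range]

theorem eval_binomPoly_natCast (a d t : ℕ) :
    (binomPoly a d).eval (t : ℂ) = ((t + a).choose d : ℂ) := by
  have h : (d ! : ℂ) ≠ 0 := by exact_mod_cast d.factorial_ne_zero
  have h2 := descPochhammer_eval_eq_descFactorial ℂ (t + a) d
  rw [Nat.descFactorial_eq_factorial_mul_choose] at h2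
  push_cast at h2
  simp [binomPoly, h2, h]

theorem eval_M_natCast (d t : ℕ) :
    (M d).eval (t : ℂ) = (((t + d).choose d + t.choose d : ℕ) : ℂ) := by
  rw [M, Polynomial.eval_add, eval_binomPoly_natCast, eval_binomPoly_natCast]
  push_cast
  simp

theorem natDegree_binomPoly_le (a d : ℕ) : (binomPoly a d).natDegree ≤ d := by
  refine (Polynomial.natDegree_C_mul_le _ _).trans ?_
  rw [Polynomial.natDegree_comp, descPochhammer_natDegree, Polynomial.natDegree_X_add_C, mul_one]

theorem coeff_binomPoly (a d : ℕ) : (binomPoly a d).coeff d = (d ! : ℂ)⁻¹ := by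
  have h := (monic_descPochhammer ℂ d).comp_X_add_C (a : ℂ)
  have hd : ((descPochhammer ℂ d).comp (Polynomial.X + Polynomial.C (a : ℂ))).natDegree = d := by
    rw [Polynomial.natDegree_comp, descPochhammer_natDegree, Polynomial.natDegree_X_add_C, mul_one]
  rw [Polynomial.Monic, Polynomial.leadingCoeff, hd] at h
  rw [binomPoly, Polynomial.coeff_C_mul, h, mul_one]

theorem coeff_M_ne_zero (d : ℕ) : (M d).coeff d ≠ 0 := by
  have h : (d ! : ℂ) ≠ 0 := by exact_mod_cast d.factorial_ne_zero
  rw [M, Polynomial.coeff_add, coeff_binomPoly, coeff_binomPoly, ← two_mul]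
  exact mul_ne_zero two_ne_zero (inv_ne_zero h)

theorem natDegree_M (d : ℕ) : (M d).natDegree = d :=
  Polynomial.natDegree_eq_of_le_of_coeff_ne_zero
    ((Polynomial.natDegree_add_le _ _).trans
      (max_le (natDegree_binomPoly_le _ _) (natDegree_binomPoly_le _ _))) (coeff_M_ne_zero d)

theorem M_ne_zero (d : ℕ) : M d ≠ 0 := fun h => coeff_M_ne_zero d (by simp [h])

theorem mk_eval_M (d : ℕ) :
    PowerSeries.mk (fun t : ℕ => (M d).eval (t : ℂ)) =
      PowerSeries.mk (fun t : ℕ => ((d + t).choose d : ℂ)) * (1 + PowerSeries.X ^ d) := by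
  ext t
  rw [mul_add, mul_one, map_add, PowerSeries.coeff_mul_X_pow']
  simp only [PowerSeries.coeff_mk, eval_M_natCast]
  split_ifs with h
  · rw [Nat.add_sub_cancel' h, add_comm d t]
    push_cast
    rfl
  · rw [Nat.choose_eq_zero_of_lt (not_le.mp h), add_comm d t]
    simp

theorem isSNN_M (d : ℕ) : IsSNN (M d) := by
  -- Two indicators are added so that for `d = 0` they overlap and give `h_0 = 2`.
  refine ⟨M_ne_zero d, fun j => (if j = 0 then 1 else 0) + (if j = d then 1 else 0),
    fun j => by positivity, ?_⟩
  rw [natDegree_M, mk_eval_M, mul_right_comm, PowerSeries.mk_add_choose_mul_one_sub_pow_eq_one,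
    one_mul]
  simp only [Complex.ofReal_add, map_add, add_mul, Finset.sum_add_distrib]
  congr 1
  · rw [Finset.sum_eq_single_of_mem 0 (by simp) fun j _ hj => by simp [hj]]
    simp
  · rw [Finset.sum_eq_single_of_mem d (by simp) fun j _ hj => by simp [hj]]
    simp

/-! ### The roots of `M d` -/

theorem eval_M_sub_half (d : ℕ) (s : ℂ) :
    (M d).eval (s - 1 / 2) = (d ! : ℂ)⁻¹ *
      (∏ j ∈ Finset.range d, (s + ((j : ℂ) + 1 / 2)) +
        ∏ j ∈ Finset.range d, (s - ((j : ℂ) + 1 / 2))) := by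
  rw [M, Polynomial.eval_add, eval_binomPoly, eval_binomPoly, ← mul_add]
  congr 2
  · rw [← Finset.prod_range_reflect]
    refine Finset.prod_congr rfl fun j hj => ?_
    have : j + 1 ≤ d := Finset.mem_range.mp hj
    rw [Nat.sub_sub, add_comm 1 j, Nat.cast_sub this]
    push_cast
    ring
  · refine Finset.prod_congr rfl fun j _ => ?_
    push_cast
    ring

theorem norm_sub_lt_norm_add {s : ℂ} (hs : 0 < s.re) {a : ℝ} (ha : 0 < a) :
    ‖s - a‖ < ‖s + a‖ := by
  refine lt_of_pow_lt_pow_left₀ 2 (norm_nonneg _) ?_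
  rw [← Complex.normSq_eq_norm_sq, ← Complex.normSq_eq_norm_sq, Complex.normSq_apply,
    Complex.normSq_apply]
  simp only [Complex.sub_re, Complex.sub_im, Complex.add_re, Complex.add_im, Complex.ofReal_re,
    Complex.ofReal_im]
  nlinarith [mul_pos hs ha]

theorem prod_norm_sub_lt {d : ℕ} (hd : d ≠ 0) {s : ℂ} (hs : 0 < s.re) :
    ∏ j ∈ Finset.range d, ‖s - ((j : ℂ) + 1 / 2)‖ <
      ∏ j ∈ Finset.range d, ‖s + ((j : ℂ) + 1 / 2)‖ := by
  have key : ∀ j : ℕ, ‖s - ((j : ℂ) + 1 / 2)‖ < ‖s + ((j : ℂ) + 1 / 2)‖ := fun j => by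
    have := norm_sub_lt_norm_add hs (a := (j : ℝ) + 1 / 2) (by positivity)
    push_cast at this
    exact this
  -- Strict monotonicity of products needs positive factors on the smaller side, so a vanishing
  -- factor is treated apart.
  by_cases h : ∃ j ∈ Finset.range d, ‖s - ((j : ℂ) + 1 / 2)‖ = 0
  · rw [Finset.prod_eq_zero_iff.mpr h]
    exact Finset.prod_pos fun j _ => (norm_nonneg _).trans_lt (key j)
  · push Not at h
    exact Finset.prod_lt_prod_of_nonempty (fun j hj => (norm_nonneg _).lt_of_ne' (h j hj))
      (fun j _ => key j) (Finset.nonempty_range_iff.mpr hd)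

/-- At a root the two products have equal norm; the strict inequality excludes positive real part
after centring, and `s ↦ -s`, which swaps the products up to sign, excludes negative real part. -/
theorem re_of_isRoot_M {d : ℕ} {s : ℂ} (h : (M d).IsRoot s) : s.re = -1 / 2 := by
  rcases eq_or_ne d 0 with rfl | hd
  · simp [M, binomPoly] at h
  have e := eval_M_sub_half d (s + 1 / 2)
  have hf : (d ! : ℂ)⁻¹ ≠ 0 := inv_ne_zero (by exact_mod_cast d.factorial_ne_zero)
  rw [add_sub_cancel_right, h.eq_zero, eq_comm, mul_eq_zero_iff_left hf,
    add_eq_zero_iff_eq_neg] at e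
  have e' := congrArg norm e
  rw [norm_neg, norm_prod, norm_prod] at e'
  rcases lt_trichotomy (s + 1 / 2).re 0 with h0 | h0 | h0
  · have := prod_norm_sub_lt hd (s := -(s + 1 / 2)) (by simp at h0 ⊢; linarith)
    simp only [← neg_add', neg_add_eq_sub, norm_neg] at this
    simp only [fun z : ℂ => norm_sub_rev z (s + 1 / 2)] at this
    exact absurd e' this.ne
  · simp at h0
    linarith
  · exact absurd e' (prod_norm_sub_lt hd h0).ne'

/-- The angle `θ = arccot (b / a)` satisfies `b = r cos θ` and `a = r sin θ` with `r = a √(1 + (b /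
a) ^ 2)`. -/
theorem exists_polar_arccot {a : ℝ} (ha : 0 < a) (b : ℝ) :
    ∃ r : ℝ, r ≠ 0 ∧
      (b * Complex.I + a : ℂ) = Complex.I * r * Complex.exp (-(arccot (b / a) * Complex.I)) ∧
      (b * Complex.I - a : ℂ) = Complex.I * r * Complex.exp (arccot (b / a) * Complex.I) := by
  have hr : 0 < √(1 + (b / a) ^ 2) := Real.sqrt_pos.mpr (by positivity)
  have hc : a * √(1 + (b / a) ^ 2) * Real.cos (arccot (b / a)) = b := by
    rw [arccot, Real.cos_pi_div_two_sub, Real.sin_arctan]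
    field_simp
  have hs : a * √(1 + (b / a) ^ 2) * Real.sin (arccot (b / a)) = a := by
    rw [arccot, Real.sin_pi_div_two_sub, Real.cos_arctan]
    field_simp
  set r := a * √(1 + (b / a) ^ 2)
  have hc' : (r * Complex.cos (arccot (b / a)) : ℂ) = b := by exact_mod_cast congrArg ((↑) : ℝ → ℂ) hc
  have hs' : (r * Complex.sin (arccot (b / a)) : ℂ) = a := by exact_mod_cast congrArg ((↑) : ℝ → ℂ) hs
  refine ⟨r, (mul_pos ha hr).ne', ?_, ?_⟩
  · rw [← neg_mul, Complex.exp_mul_I, Complex.cos_neg, Complex.sin_neg]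
    linear_combination (-Complex.I) * hc' - hs' + r * Complex.sin (arccot (b / a)) * Complex.I_sq
  · rw [Complex.exp_mul_I]
    linear_combination (-Complex.I) * hc' + hs' - r * Complex.sin (arccot (b / a)) * Complex.I_sq

theorem isRoot_M_iff_cos_eq_zero (d : ℕ) (b : ℝ) :
    (M d).IsRoot (b * Complex.I - 1 / 2) ↔ Real.cos (arccotSum d b) = 0 := by
  have hf : (d ! : ℂ)⁻¹ ≠ 0 := inv_ne_zero (by exact_mod_cast d.factorial_ne_zero)
  choose r hr hadd hsub using fun j : ℕ =>
    exists_polar_arccot (a := (j : ℝ) + 1 / 2) (by positivity) b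
  have hP : ∏ j ∈ Finset.range d, (Complex.I * r j) ≠ 0 :=
    Finset.prod_ne_zero_iff.mpr fun j _ =>
      mul_ne_zero Complex.I_ne_zero (by exact_mod_cast hr j)
  have h1 : ∏ j ∈ Finset.range d, (b * Complex.I + ((j : ℂ) + 1 / 2)) =
      (∏ j ∈ Finset.range d, (Complex.I * r j)) *
        Complex.exp (-(arccotSum d b * Complex.I)) := by
    rw [arccotSum, Complex.ofReal_sum, Finset.sum_mul, ← Finset.sum_neg_distrib, Complex.exp_sum,
      ← Finset.prod_mul_distrib]
    refine Finset.prod_congr rfl fun j _ => ?_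
    rw [← hadd]
    push_cast
    rfl
  have h2 : ∏ j ∈ Finset.range d, (b * Complex.I - ((j : ℂ) + 1 / 2)) =
      (∏ j ∈ Finset.range d, (Complex.I * r j)) * Complex.exp (arccotSum d b * Complex.I) := by
    rw [arccotSum, Complex.ofReal_sum, Finset.sum_mul, Complex.exp_sum, ← Finset.prod_mul_distrib]
    refine Finset.prod_congr rfl fun j _ => ?_
    rw [← hsub]
    push_cast
    rfl
  rw [Polynomial.IsRoot, eval_M_sub_half, h1, h2, ← mul_add, mul_eq_zero_iff_left hf,
    mul_eq_zero_iff_left hP, add_comm, ← neg_mul, ← Complex.two_cos, mul_eq_zero_iff_left two_ne_zero,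
    ← Complex.ofReal_cos, Complex.ofReal_eq_zero]

theorem isRoot_M_iff (d : ℕ) (s : ℂ) :
    (M d).IsRoot s ↔ s.re = -1 / 2 ∧ Real.cos (arccotSum d s.im) = 0 := by
  have key : s.re = -1 / 2 → s = s.im * Complex.I - 1 / 2 := fun h => by
    apply Complex.ext <;> simp [h]; norm_num
  constructor
  · intro h
    have hre := re_of_isRoot_M h
    refine ⟨hre, (isRoot_M_iff_cos_eq_zero d s.im).mp ?_⟩
    rwa [← key hre]
  · rintro ⟨hre, h⟩
    rw [key hre]
    exact (isRoot_M_iff_cos_eq_zero d s.im).mpr h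

/-! ### The function `arccotSum d` -/

theorem arccot_strictAnti : StrictAnti arccot := fun _ _ h =>
  sub_lt_sub_left (Real.arctan_strictMono h) _

theorem arccot_pos (x : ℝ) : 0 < arccot x := sub_pos.mpr (Real.arctan_lt_pi_div_two x)

theorem arccotSum_strictAnti {d : ℕ} (hd : 1 ≤ d) : StrictAnti (arccotSum d) := fun x y h =>
  Finset.sum_lt_sum_of_nonempty (Finset.nonempty_range_iff.mpr (by lia)) fun j _ =>
    arccot_strictAnti (div_lt_div_of_pos_right h (by positivity))

theorem arccotSum_nonneg (d : ℕ) (b : ℝ) : 0 ≤ arccotSum d b :=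
  Finset.sum_nonneg fun _ _ => (arccot_pos _).le

theorem continuous_arccotSum (d : ℕ) : Continuous (arccotSum d) := by
  unfold arccotSum arccot
  fun_prop

theorem arccotSum_neg (d : ℕ) (b : ℝ) : arccotSum d (-b) = d * Real.pi - arccotSum d b := by
  rw [eq_sub_iff_add_eq, arccotSum, arccotSum, ← Finset.sum_add_distrib]
  simp [arccot, neg_div, Real.arctan_neg]

theorem arccot_of_pos {x : ℝ} (hx : 0 < x) : arccot x = Real.arctan x⁻¹ :=
  (Real.arctan_inv_of_pos hx).symm

theorem sum_range_add_half (d : ℕ) :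
    ∑ j ∈ Finset.range d, ((j : ℝ) + 1 / 2) = (d : ℝ) ^ 2 / 2 := by
  induction d with
  | zero => simp
  | succ d ih =>
    rw [Finset.sum_range_succ, ih]
    push_cast
    ring

theorem arctan_le_of_nonneg {x : ℝ} (hx : 0 ≤ x) : Real.arctan x ≤ x := by
  have h : MonotoneOn (fun x => x - Real.arctan x) (Set.Ici 0) := by
    refine monotoneOn_of_hasDerivWithinAt_nonneg (f' := fun x => 1 - 1 / (1 + x ^ 2))
      (convex_Ici 0) (by fun_prop) (fun x _ =>
        ((hasDerivAt_id x).sub (Real.hasDerivAt_arctan x)).hasDerivWithinAt) fun x _ => ?_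
    rw [sub_nonneg, div_le_one (by positivity)]
    nlinarith
  have := h (Set.mem_Ici.mpr le_rfl) hx hx
  simp at this
  exact this

theorem sub_cube_le_arctan {x : ℝ} (hx : 0 ≤ x) : x - x ^ 3 / 3 ≤ Real.arctan x := by
  have h : MonotoneOn (fun x => Real.arctan x - (x - x ^ 3 / 3)) (Set.Ici 0) := by
    refine monotoneOn_of_hasDerivWithinAt_nonneg
      (f' := fun x => 1 / (1 + x ^ 2) - (1 - x ^ 2)) (convex_Ici 0) (by fun_prop) (fun x _ => ?_)
      fun x _ => ?_
    · have := (Real.hasDerivAt_arctan x).sub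
        ((hasDerivAt_id x).sub (((hasDerivAt_id x).pow 3).div_const 3))
      refine HasDerivAt.hasDerivWithinAt (this.congr_deriv ?_)
      simp
    · rw [sub_nonneg, le_div_iff₀ (by positivity)]
      nlinarith [sq_nonneg (x ^ 2)]
  have := h (Set.mem_Ici.mpr le_rfl) hx hx
  simp at this
  linarith

theorem arccotSum_le {d : ℕ} {b : ℝ} (hb : 0 < b) : arccotSum d b ≤ (d : ℝ) ^ 2 / (2 * b) := by
  calc arccotSum d b ≤ ∑ j ∈ Finset.range d, ((j : ℝ) + 1 / 2) / b := by
        refine Finset.sum_le_sum fun j _ => ?_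
        rw [arccot_of_pos (by positivity), inv_div]
        exact arctan_le_of_nonneg (by positivity)
    _ = (d : ℝ) ^ 2 / (2 * b) := by
        rw [← Finset.sum_div, sum_range_add_half, div_div]

theorem le_arccotSum {d : ℕ} {b : ℝ} (hb : 0 < b) :
    (d : ℝ) ^ 2 / (2 * b) - (d : ℝ) ^ 4 / (3 * b ^ 3) ≤ arccotSum d b := by
  have hcube : ∑ j ∈ Finset.range d, ((j : ℝ) + 1 / 2) ^ 3 ≤ (d : ℝ) ^ 4 := by
    calc ∑ j ∈ Finset.range d, ((j : ℝ) + 1 / 2) ^ 3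
        ≤ ∑ j ∈ Finset.range d, (d : ℝ) ^ 3 := by
          refine Finset.sum_le_sum fun j hj => ?_
          have : (j : ℝ) + 1 ≤ d := by exact_mod_cast Finset.mem_range.mp hj
          gcongr
          linarith
      _ = (d : ℝ) ^ 4 := by simp; ring
  calc (d : ℝ) ^ 2 / (2 * b) - (d : ℝ) ^ 4 / (3 * b ^ 3)
      ≤ (d : ℝ) ^ 2 / (2 * b) -
          (∑ j ∈ Finset.range d, ((j : ℝ) + 1 / 2) ^ 3) / (3 * b ^ 3) := by gcongr
    _ = ∑ j ∈ Finset.range d,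
          (((j : ℝ) + 1 / 2) / b - (((j : ℝ) + 1 / 2) / b) ^ 3 / 3) := by
        rw [Finset.sum_sub_distrib, ← Finset.sum_div, sum_range_add_half, Finset.sum_div]
        congr 1
        · rw [div_div]
        · refine Finset.sum_congr rfl fun j _ => ?_
          rw [div_pow, div_div, mul_comm]
    _ ≤ arccotSum d b := by
        refine Finset.sum_le_sum fun j _ => ?_
        rw [arccot_of_pos (by positivity), inv_div]
        exact sub_cube_le_arctan (by positivity)

theorem exists_arccotSum_eq {d : ℕ} (hd : 1 ≤ d) :
    ∃ b : ℝ, 0 ≤ b ∧ arccotSum d b = Real.pi / 2 := by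
  have hd' : (1 : ℝ) ≤ d := by exact_mod_cast hd
  have h0 : Real.pi / 2 ≤ arccotSum d 0 := by
    simp only [arccotSum, arccot, zero_div, Real.arctan_zero, sub_zero, Finset.sum_const,
      Finset.card_range, nsmul_eq_mul]
    nlinarith [Real.pi_pos]
  have h1 : arccotSum d ((d : ℝ) ^ 2 / Real.pi) ≤ Real.pi / 2 := by
    refine (arccotSum_le (by positivity)).trans_eq ?_
    field_simp
  obtain ⟨b, hb, hb'⟩ := intermediate_value_Icc' (show (0 : ℝ) ≤ (d : ℝ) ^ 2 / Real.pi by positivity)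
    (continuous_arccotSum d).continuousOn ⟨h1, h0⟩
  exact ⟨b, hb.1, hb'⟩

theorem existsUnique_arccotSum_eq {d : ℕ} (hd : 1 ≤ d) :
    ∃ b : ℝ, 0 ≤ b ∧ ∀ x : ℝ, arccotSum d x = Real.pi / 2 ↔ x = b := by
  obtain ⟨b, hb, hb'⟩ := exists_arccotSum_eq hd
  exact ⟨b, hb, fun x => by rw [← hb', (arccotSum_strictAnti hd).injective.eq_iff]⟩

/-! ### The roots of maximal norm -/

/-- Reflection turns `p_d(b)` into `d π - p_d(b)`, which changes the cosine only by a sign. -/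
theorem cos_arccotSum_abs_eq_zero_iff (d : ℕ) (x : ℝ) :
    Real.cos (arccotSum d |x|) = 0 ↔ Real.cos (arccotSum d x) = 0 := by
  rcases abs_choice x with h | h
  · rw [h]
  · rw [h, arccotSum_neg, Real.cos_nat_mul_pi_sub]
    simp

theorem pi_div_two_le_of_cos_eq_zero {x : ℝ} (hx : 0 ≤ x) (h : Real.cos x = 0) :
    Real.pi / 2 ≤ x := by
  by_contra! hlt
  exact (Real.cos_pos_of_mem_Ioo ⟨by linarith [Real.pi_pos], hlt⟩).ne' h

theorem norm_le_norm_iff_abs_im_le {s t : ℂ} (h : s.re = t.re) : ‖s‖ ≤ ‖t‖ ↔ |s.im| ≤ |t.im| := by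
  rw [← sq_le_sq, ← sq_le_sq₀ (norm_nonneg _) (norm_nonneg _), ← Complex.normSq_eq_norm_sq,
    ← Complex.normSq_eq_norm_sq, Complex.normSq_apply, Complex.normSq_apply, h,
    add_le_add_iff_left, sq, sq]

theorem isMaxNormRoot_M_iff {d : ℕ} (hd : 1 ≤ d) (s : ℂ) :
    IsMaxNormRoot (M d) s ↔ s.re = -1 / 2 ∧ arccotSum d |s.im| = Real.pi / 2 := by
  obtain ⟨b, hb, hb'⟩ := exists_arccotSum_eq hd
  have abs_le : ∀ t : ℂ, (M d).IsRoot t → |t.im| ≤ b := fun t ht => by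
    have := pi_div_two_le_of_cos_eq_zero (arccotSum_nonneg d _)
      ((cos_arccotSum_abs_eq_zero_iff d t.im).mpr ((isRoot_M_iff d t).mp ht).2)
    rwa [← hb', (arccotSum_strictAnti hd).le_iff_ge] at this
  have hre : ∀ t : ℂ, (M d).IsRoot t → t.re = -1 / 2 := fun t => re_of_isRoot_M
  constructor
  · rintro ⟨hs, hmax⟩
    refine ⟨hre s hs, ?_⟩
    have hroot : (M d).IsRoot ⟨-1 / 2, b⟩ := (isRoot_M_iff d _).mpr ⟨rfl, by simp [hb']⟩
    have h1 := (norm_le_norm_iff_abs_im_le ((hre _ hroot).trans (hre s hs).symm)).mp (hmax _ hroot)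
    rw [abs_of_nonneg hb] at h1
    rw [(abs_le s hs).antisymm h1, hb']
  · rintro ⟨hs, hsum⟩
    have hroot : (M d).IsRoot s := by
      rw [isRoot_M_iff, ← cos_arccotSum_abs_eq_zero_iff, hsum]
      exact ⟨hs, Real.cos_pi_div_two⟩
    refine ⟨hroot, fun t ht => (norm_le_norm_iff_abs_im_le ((hre t ht).trans hs.symm)).mpr ?_⟩
    rw [(arccotSum_strictAnti hd).injective (hsum.trans hb'.symm)]
    exact abs_le t ht

theorem le_of_arccotSum_eq {d : ℕ} (hd : 1 ≤ d) {b : ℝ} (hb : arccotSum d b = Real.pi / 2) :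
    b ≤ (d : ℝ) ^ 2 / Real.pi := by
  have hd' : (0 : ℝ) < d := by exact_mod_cast hd
  rw [← (arccotSum_strictAnti hd).le_iff_ge, hb]
  refine (arccotSum_le (by positivity)).trans_eq ?_
  field_simp

theorem le_of_arccotSum_eq_of_large {d : ℕ} (hd : 8 ≤ d) {b : ℝ}
    (hb : arccotSum d b = Real.pi / 2) : (d : ℝ) ^ 2 / Real.pi - 8 * Real.pi / 3 ≤ b := by
  have hd' : (8 : ℝ) ≤ d := by exact_mod_cast hd
  have hpi := Real.pi_pos
  have hpi' : Real.pi ^ 2 ≤ 10 := by nlinarith [Real.pi_lt_d2, Real.pi_gt_three]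
  rw [← (arccotSum_strictAnti (show 1 ≤ d by lia)).le_iff_ge, hb]
  -- With this `B`, `d ^ 2 / (2 B) = π / 2 + 4 π ^ 2 / (3 B)`, and `d ^ 2 ≤ 2 π B` bounds the cubic
  -- error by exactly `4 π ^ 2 / (3 B)`. That inequality means `d ^ 2 ≥ 16 π ^ 2 / 3`, whence `d ≥
  -- 8`.
  set B := (d : ℝ) ^ 2 / Real.pi - 8 * Real.pi / 3 with hB
  have hBpi : Real.pi * B = (d : ℝ) ^ 2 - 8 * Real.pi ^ 2 / 3 := by
    rw [hB]
    field_simp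
  have hBd : (d : ℝ) ^ 2 ≤ 2 * (Real.pi * B) := by
    rw [hBpi]
    nlinarith
  have hBpos : 0 < B := by
    by_contra! h
    nlinarith [mul_nonneg hpi.le (neg_nonneg.mpr h)]
  refine le_trans ?_ (le_arccotSum hBpos)
  have h4 : (d : ℝ) ^ 4 ≤ 4 * Real.pi ^ 2 * B ^ 2 := by
    calc (d : ℝ) ^ 4 = ((d : ℝ) ^ 2) ^ 2 := by ring
      _ ≤ (2 * (Real.pi * B)) ^ 2 := by gcongr
      _ = _ := by ring
  have e : (d : ℝ) ^ 2 / (2 * B) - (d : ℝ) ^ 4 / (3 * B ^ 3) =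
      (3 * (d : ℝ) ^ 2 * B ^ 2 - 2 * (d : ℝ) ^ 4) / (6 * B ^ 3) := by
    field_simp
    ring
  rw [e, le_div_iff₀ (by positivity)]
  have e2 : Real.pi / 2 * (6 * B ^ 3) = 3 * ((d : ℝ) ^ 2 - 8 * Real.pi ^ 2 / 3) * B ^ 2 := by
    rw [← hBpi]
    ring
  rw [e2]
  nlinarith

theorem norm_maxNormRoot_isBigO {β : ℕ → ℂ} (hβ : ∀ d : ℕ, 1 ≤ d → IsMaxNormRoot (M d) (β d)) :
    (fun d : ℕ => ‖β d + 1 / 2‖ - (d : ℝ) ^ 2 / Real.pi) =O[atTop] (fun _ : ℕ => (1 : ℝ)) := by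
  refine IsBigO.of_bound (8 * Real.pi / 3) ?_
  filter_upwards [eventually_ge_atTop 8] with d hd
  have hd1 : 1 ≤ d := by lia
  obtain ⟨hre, hsum⟩ := (isMaxNormRoot_M_iff hd1 _).mp (hβ d hd1)
  have e : β d + 1 / 2 = (β d).im * Complex.I := by
    apply Complex.ext <;> simp [hre]; norm_num
  have hn : ‖β d + 1 / 2‖ = |(β d).im| := by rw [e]; simp
  rw [hn, norm_one, mul_one, Real.norm_eq_abs, abs_le]
  constructor
  · linarith [le_of_arccotSum_eq_of_large hd hsum]
  · linarith [le_of_arccotSum_eq hd1 hsum, Real.pi_pos]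

/-! ### Lattice points of dilated lattice polytopes -/

section Polytope

variable {n : ℕ}

/-- The lattice polytope spanned by a finite set of lattice points. -/
def latticeHull (S : Finset (Fin n → ℤ)) : Set (Fin n → ℝ) :=
  convexHull ℝ (latticePoint '' (S : Set (Fin n → ℤ)))

/-- The lattice points of the dilate `t • P`. -/
def dilatePoints (P : Set (Fin n → ℝ)) (t : ℕ) : Set (Fin n → ℤ) :=
  {z | latticePoint z ∈ (t : ℝ) • P}

theorem latticePoint_injective : Function.Injective (latticePoint (n := n)) := fun x y h => by
  funext i
  exact Int.cast_injective (congrFun h i)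

theorem mem_latticeHull {S : Finset (Fin n → ℤ)} {x : Fin n → ℝ} :
    x ∈ latticeHull S ↔ ∃ c : (Fin n → ℤ) → ℝ, (∀ v ∈ S, 0 ≤ c v) ∧ ∑ v ∈ S, c v = 1 ∧
      ∑ v ∈ S, c v • latticePoint v = x := by
  classical
  have hinj : Set.InjOn (latticePoint (n := n)) S := latticePoint_injective.injOn
  rw [latticeHull, ← Finset.coe_image, Finset.mem_convexHull']
  constructor
  · rintro ⟨w, h0, h1, hx⟩
    rw [Finset.sum_image hinj] at h1 hx
    exact ⟨w ∘ latticePoint, fun v hv => h0 _ (Finset.mem_image_of_mem _ hv), h1, hx⟩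
  · rintro ⟨c, h0, h1, hx⟩
    have e : ∀ v : Fin n → ℤ, Function.invFun latticePoint (latticePoint v) = v :=
      Function.leftInverse_invFun latticePoint_injective
    refine ⟨c ∘ Function.invFun latticePoint, ?_, ?_, ?_⟩
    · simpa [e] using h0
    · rw [Finset.sum_image hinj]
      simpa [e] using h1
    · rw [Finset.sum_image hinj]
      simpa [e] using hx

theorem mem_smul_latticeHull {S : Finset (Fin n → ℤ)} (hS : S.Nonempty) {t : ℕ}
    {x : Fin n → ℝ} :
    x ∈ (t : ℝ) • latticeHull S ↔ ∃ c : (Fin n → ℤ) → ℝ, (∀ v ∈ S, 0 ≤ c v) ∧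
      ∑ v ∈ S, c v = t ∧ ∑ v ∈ S, c v • latticePoint v = x := by
  rw [Set.mem_smul_set]
  constructor
  · rintro ⟨y, hy, rfl⟩
    obtain ⟨c, h0, h1, rfl⟩ := mem_latticeHull.mp hy
    refine ⟨fun v => t * c v, fun v hv => mul_nonneg t.cast_nonneg (h0 v hv), ?_, ?_⟩
    · rw [← Finset.mul_sum, h1, mul_one]
    · rw [Finset.smul_sum]
      simp only [mul_smul]
  · rintro ⟨c, h0, h1, rfl⟩
    rcases eq_or_ne t 0 with rfl | ht
    · obtain ⟨v, hv⟩ := hS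
      refine ⟨latticePoint v, subset_convexHull _ _ ⟨v, hv, rfl⟩, ?_⟩
      rw [Nat.cast_zero] at h1
      have hc := (Finset.sum_eq_zero_iff_of_nonneg h0).mp h1
      rw [Nat.cast_zero, zero_smul, Finset.sum_eq_zero fun v hv => by rw [hc v hv, zero_smul]]
    · have ht' : (t : ℝ) ≠ 0 := by exact_mod_cast ht
      refine ⟨∑ v ∈ S, (c v / t) • latticePoint v, mem_latticeHull.mpr
        ⟨fun v => c v / t, fun v hv => div_nonneg (h0 v hv) t.cast_nonneg, ?_, rfl⟩, ?_⟩
      · rw [← Finset.sum_div, h1, div_self ht']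
      · rw [Finset.smul_sum]
        simp only [smul_smul, mul_div_cancel₀ _ ht']

theorem sum_smul_latticePoint_eq_iff {S : Finset (Fin n → ℤ)} {c : (Fin n → ℤ) → ℝ}
    {z : Fin n → ℤ} :
    ∑ v ∈ S, c v • latticePoint v = latticePoint z ↔ ∀ i, ∑ v ∈ S, c v * (v i : ℝ) = z i := by
  simp [funext_iff, latticePoint]

theorem mem_dilatePoints_latticeHull {S : Finset (Fin n → ℤ)} (hS : S.Nonempty) {t : ℕ}
    {z : Fin n → ℤ} :
    z ∈ dilatePoints (latticeHull S) t ↔ ∃ c : (Fin n → ℤ) → ℝ, (∀ v ∈ S, 0 ≤ c v) ∧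
      ∑ v ∈ S, c v = t ∧ ∀ i, ∑ v ∈ S, c v * (v i : ℝ) = z i := by
  simp only [dilatePoints, Set.mem_ofPred_eq, mem_smul_latticeHull hS, sum_smul_latticePoint_eq_iff]

theorem finite_dilatePoints {P : Set (Fin n → ℝ)} (hP : Bornology.IsBounded P) (t : ℕ) :
    (dilatePoints P t).Finite := by
  obtain ⟨R, hR⟩ := (hP.smul₀ (t : ℝ)).exists_norm_le
  refine (Set.finite_Icc (fun _ : Fin n => -⌈R⌉) (fun _ => ⌈R⌉)).subset fun z hz => ?_
  have h : ∀ i, |(z i : ℝ)| ≤ ⌈R⌉ := fun i =>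
    (norm_le_pi_norm (latticePoint z) i).trans ((hR _ hz).trans (Int.le_ceil R))
  refine ⟨fun i => ?_, fun i => ?_⟩
  · exact_mod_cast (abs_le.mp (h i)).1
  · exact_mod_cast (abs_le.mp (h i)).2

theorem isBounded_latticeHull (S : Finset (Fin n → ℤ)) : Bornology.IsBounded (latticeHull S) :=
  isBounded_convexHull.mpr (S.finite_toSet.image _).isBounded

theorem sum_nsmul_mem_dilatePoints {S : Finset (Fin n → ℤ)} (hS : S.Nonempty)
    (a : (Fin n → ℤ) → ℕ) :
    ∑ v ∈ S, a v • v ∈ dilatePoints (latticeHull S) (∑ v ∈ S, a v) :=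
  (mem_dilatePoints_latticeHull hS).mpr ⟨fun v => a v, fun _ _ => Nat.cast_nonneg _,
    by push_cast; rfl, fun i => by simp⟩

/-- A polytope spanned by `k + 1` lattice points has `O(t ^ k)` lattice points in its `t`-th
dilate. -/
theorem exists_ncard_dilatePoints_le {S : Finset (Fin n → ℤ)} (hS : S.Nonempty) {k : ℕ}
    (hk : S.card ≤ k + 1) :
    ∃ N : ℕ, ∀ t : ℕ, (dilatePoints (latticeHull S) t).ncard ≤ N * (t + 1) ^ k := by
  classical
  obtain ⟨v₀, hv₀⟩ := hS
  set S' := S.erase v₀ with hS'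
  set B : Fin n → ℤ := fun i => ∑ v ∈ S', |v i - v₀ i| with hB
  refine ⟨(Finset.Icc (-B) B).card, fun t => ?_⟩
  -- Eliminating the coefficient of `v₀` and splitting the others into integer and fractional parts,
  -- `z` is `t v₀` plus integer multiples of `v - v₀` plus a remainder in a box independent of `t`.
  set F : (Fin n → ℤ) × (S' → Fin (t + 1)) → (Fin n → ℤ) := fun p i =>
    p.1 i + t * v₀ i + ∑ v : S', ((p.2 v : ℕ) : ℤ) * (v.1 i - v₀ i) with hF
  have hsub : dilatePoints (latticeHull S) t ⊆
      ((Finset.Icc (-B) B ×ˢ Finset.univ).image F : Finset (Fin n → ℤ)) := by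
    intro z hz
    obtain ⟨c, h0, h1, hz⟩ := (mem_dilatePoints_latticeHull ⟨v₀, hv₀⟩).mp hz
    have hle : ∀ v ∈ S, c v ≤ t := fun v hv => h1 ▸ Finset.single_le_sum h0 hv
    have hsum : c v₀ = t - ∑ v ∈ S', c v := by
      rw [← h1, ← Finset.add_sum_erase S c hv₀]
      ring
    have hz' : ∀ i, (z i : ℝ) = t * v₀ i + ∑ v ∈ S', c v * ((v i : ℝ) - v₀ i) := fun i => by
      rw [← hz i, ← Finset.add_sum_erase S _ hv₀, hsum]
      simp only [mul_sub, Finset.sum_sub_distrib, ← Finset.sum_mul]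
      ring
    let a : S' → Fin (t + 1) := fun v => ⟨⌊c v⌋₊, by
      have := Nat.floor_le_floor (hle v (Finset.mem_of_mem_erase v.2))
      rw [Nat.floor_natCast] at this
      lia⟩
    let b : Fin n → ℤ := fun i => z i - t * v₀ i - ∑ v ∈ S', (⌊c v⌋₊ : ℤ) * (v i - v₀ i)
    have hb : ∀ i, |b i| ≤ B i := fun i => by
      have e : ((b i : ℤ) : ℝ) = ∑ v ∈ S', (c v - ⌊c v⌋₊) * ((v i : ℝ) - v₀ i) := by
        simp only [b]
        push_cast
        rw [hz' i]
        simp only [sub_mul, Finset.sum_sub_distrib]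
        ring
      have : |((b i : ℤ) : ℝ)| ≤ ∑ v ∈ S', |(v i : ℝ) - v₀ i| := by
        rw [e]
        refine (Finset.abs_sum_le_sum_abs _ _).trans (Finset.sum_le_sum fun v hv => ?_)
        rw [abs_mul]
        refine mul_le_of_le_one_left (abs_nonneg _) (abs_le.mpr ⟨?_, ?_⟩)
        · linarith [Nat.floor_le (h0 v (Finset.mem_of_mem_erase hv))]
        · linarith [Nat.lt_floor_add_one (c v)]
      exact_mod_cast this
    rw [Finset.mem_coe, Finset.mem_image]
    refine ⟨(b, a), Finset.mem_product.mpr ⟨Finset.mem_Icc.mpr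
      ⟨fun i => (abs_le.mp (hb i)).1, fun i => (abs_le.mp (hb i)).2⟩, Finset.mem_univ _⟩, ?_⟩
    funext i
    simp only [hF, b, a]
    rw [Finset.sum_coe_sort S' fun v => (⌊c v⌋₊ : ℤ) * (v i - v₀ i)]
    ring
  have hcard : S'.card ≤ k := by
    rw [hS', Finset.card_erase_of_mem hv₀]
    lia
  calc (dilatePoints (latticeHull S) t).ncard
      ≤ ((Finset.Icc (-B) B ×ˢ Finset.univ).image F).card := by
        rw [← Set.ncard_coe_finset]
        exact Set.ncard_le_ncard hsub (Finset.finite_toSet _)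
    _ ≤ (Finset.Icc (-B) B ×ˢ (Finset.univ : Finset (S' → Fin (t + 1)))).card :=
        Finset.card_image_le
    _ = (Finset.Icc (-B) B).card * (t + 1) ^ S'.card := by
        rw [Finset.card_product, Finset.card_univ, Fintype.card_fun, Fintype.card_fin,
          Fintype.card_coe]
    _ ≤ (Finset.Icc (-B) B).card * (t + 1) ^ k := by
        gcongr
        lia

/-- Affine independence of a finite set of lattice points. -/
def LatticeAffineIndependent (S : Finset (Fin n → ℤ)) : Prop :=
  ∀ c : (Fin n → ℤ) → ℝ, ∑ v ∈ S, c v = 0 → (∀ i, ∑ v ∈ S, c v * (v i : ℝ) = 0) →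
    ∀ v ∈ S, c v = 0

theorem latticeAffineIndependent_of_affineIndependent [DecidableEq (Fin n → ℝ)]
    {S : Finset (Fin n → ℤ)}
    (h : AffineIndependent ℝ (Subtype.val : S.image latticePoint → (Fin n → ℝ))) :
    LatticeAffineIndependent S := by
  intro c h0 h1 v hv
  let e : S ↪ S.image latticePoint :=
    ⟨fun v => ⟨latticePoint v.1, Finset.mem_image_of_mem _ v.2⟩, fun x y hxy =>
      Subtype.ext (latticePoint_injective (congrArg Subtype.val hxy))⟩
  have := affineIndependent_iff.mp (h.comp_embedding e) Finset.univ (fun v => c v)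
  refine this ?_ ?_ ⟨v, hv⟩ (Finset.mem_univ _)
  · rw [Finset.univ_eq_attach, Finset.sum_attach S c, h0]
  · change ∑ v : S, c v • latticePoint v.1 = 0
    rw [Finset.univ_eq_attach, Finset.sum_attach S fun v => c v • latticePoint v]
    funext i
    simpa [latticePoint] using h1 i

/-- Carathéodory's theorem for lattice polytopes. -/
theorem exists_latticeAffineIndependent_of_mem {S : Finset (Fin n → ℤ)} {x : Fin n → ℝ}
    (hx : x ∈ latticeHull S) :
    ∃ T ⊆ S, T.Nonempty ∧ LatticeAffineIndependent T ∧ x ∈ latticeHull T := by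
  classical
  rw [latticeHull, convexHull_eq_union] at hx
  simp only [Set.mem_iUnion] at hx
  obtain ⟨t, hts, ht, hx⟩ := hx
  rw [← Finset.coe_image, Finset.coe_subset, Finset.subset_image_iff] at hts
  obtain ⟨T, hTS, rfl⟩ := hts
  refine ⟨T, hTS, ?_, latticeAffineIndependent_of_affineIndependent ht, ?_⟩
  · rw [Finset.nonempty_iff_ne_empty]
    rintro rfl
    simp at hx
  · rwa [latticeHull, ← Finset.coe_image]

/-- By Carathéodory the hull is covered by hulls of independent subsets; as `S` is dependent these
are proper, so each has at most `k + 1` points and contributes `O(t ^ k)`. -/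
theorem exists_ncard_dilatePoints_le_of_not_independent {S : Finset (Fin n → ℤ)} {k : ℕ}
    (hk : S.card ≤ k + 2) (hS : ¬ LatticeAffineIndependent S) :
    ∃ N : ℕ, ∀ t : ℕ, (dilatePoints (latticeHull S) t).ncard ≤ N * (t + 1) ^ k := by
  classical
  have key : ∀ T : Finset (Fin n → ℤ), ∃ N : ℕ, T.Nonempty → T.card ≤ k + 1 →
      ∀ t : ℕ, (dilatePoints (latticeHull T) t).ncard ≤ N * (t + 1) ^ k := fun T => by
    by_cases h : T.Nonempty ∧ T.card ≤ k + 1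
    · obtain ⟨N, hN⟩ := exists_ncard_dilatePoints_le h.1 h.2
      exact ⟨N, fun _ _ => hN⟩
    · exact ⟨0, fun h1 h2 => absurd ⟨h1, h2⟩ h⟩
  choose N hN using key
  set 𝒯 := S.powerset.filter fun T => T.Nonempty ∧ T.card ≤ k + 1 with h𝒯
  refine ⟨∑ T ∈ 𝒯, N T, fun t => ?_⟩
  have hsub : dilatePoints (latticeHull S) t ⊆ ⋃ T ∈ 𝒯, dilatePoints (latticeHull T) t := by
    intro z hz
    obtain ⟨y, hy, hyz⟩ := Set.mem_smul_set.mp hz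
    obtain ⟨T, hTS, hT, hTi, hyT⟩ := exists_latticeAffineIndependent_of_mem hy
    have hne : T ≠ S := fun h => hS (h ▸ hTi)
    have hlt := Finset.card_lt_card (hTS.ssubset_of_ne hne)
    refine Set.mem_biUnion (x := T) ?_ (Set.mem_smul_set.mpr ⟨y, hyT, hyz⟩)
    simp only [h𝒯, Finset.mem_powerset, Finset.coe_filter, Set.mem_ofPred_eq]
    exact ⟨hTS, hT, by lia⟩
  calc (dilatePoints (latticeHull S) t).ncard
      ≤ (⋃ T ∈ 𝒯, dilatePoints (latticeHull T) t).ncard :=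
        Set.ncard_le_ncard hsub (𝒯.finite_toSet.biUnion fun T _ =>
          finite_dilatePoints (isBounded_latticeHull T) t)
    _ ≤ ∑ T ∈ 𝒯, (dilatePoints (latticeHull T) t).ncard := Finset.set_ncard_biUnion_le _ _
    _ ≤ ∑ T ∈ 𝒯, N T * (t + 1) ^ k := Finset.sum_le_sum fun T hT => by
        obtain ⟨-, h1, h2⟩ := Finset.mem_filter.mp hT
        exact hN T h1 h2 t
    _ = (∑ T ∈ 𝒯, N T) * (t + 1) ^ k := (Finset.sum_mul _ _ _).symm

/-- The lattice points of the `t`-th dilate that are sums of `t` points of `S`. -/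
def sumPoints (S : Finset (Fin n → ℤ)) (t : ℕ) : Set (Fin n → ℤ) :=
  {z | ∃ a : (Fin n → ℤ) → ℕ, ∑ v ∈ S, a v = t ∧ ∑ v ∈ S, a v • v = z}

theorem sumPoints_subset {S : Finset (Fin n → ℤ)} (hS : S.Nonempty) (t : ℕ) :
    sumPoints S t ⊆ dilatePoints (latticeHull S) t := by
  rintro z ⟨a, rfl, rfl⟩
  exact sum_nsmul_mem_dilatePoints hS a

theorem LatticeAffineIndependent.eq_of_sum_eq {S : Finset (Fin n → ℤ)}
    (hS : LatticeAffineIndependent S) {c c' : (Fin n → ℤ) → ℝ}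
    (h0 : ∑ v ∈ S, c v = ∑ v ∈ S, c' v)
    (h1 : ∀ i, ∑ v ∈ S, c v * (v i : ℝ) = ∑ v ∈ S, c' v * (v i : ℝ)) :
    ∀ v ∈ S, c v = c' v := fun v hv =>
  sub_eq_zero.mp (hS (fun v => c v - c' v) (by rw [Finset.sum_sub_distrib, h0, sub_self])
    (fun i => by simp only [sub_mul, Finset.sum_sub_distrib, h1, sub_self]) v hv)

/-- Independence makes the multiplicities unique, so this is stars and bars. -/
theorem LatticeAffineIndependent.ncard_sumPoints {S : Finset (Fin n → ℤ)}
    (hS : LatticeAffineIndependent S) (t : ℕ) :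
    (sumPoints S t).ncard = (S.card + t - 1).choose t := by
  classical
  let F : ((Fin n → ℤ) →₀ ℕ) → (Fin n → ℤ) := fun a => ∑ v ∈ S, a v • v
  have e : sumPoints S t = ((S.finsuppAntidiag t).image F : Finset (Fin n → ℤ)) := by
    ext z
    simp only [sumPoints, Set.mem_ofPred_eq, Finset.coe_image, Set.mem_image, Finset.mem_coe,
      Finset.mem_finsuppAntidiag, F]
    constructor
    · rintro ⟨a, ha, rfl⟩
      refine ⟨Finsupp.onFinset S (fun v => if v ∈ S then a v else 0) (fun v hv => by
        by_contra h
        simp [h] at hv), ⟨?_, Finsupp.support_onFinset_subset⟩, ?_⟩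
      · rw [← ha]
        exact Finset.sum_congr rfl fun v hv => by simp [hv]
      · exact Finset.sum_congr rfl fun v hv => by simp [hv]
    · rintro ⟨a, ⟨ha, -⟩, rfl⟩
      exact ⟨a, ha, rfl⟩
  rw [e, Set.ncard_coe_finset, Finset.card_image_of_injOn, Finset.card_finsuppAntidiag_nat_eq_choose]
  intro a ha b hb hab
  rw [Finset.mem_coe, Finset.mem_finsuppAntidiag] at ha hb
  have h := hS.eq_of_sum_eq (c := fun v => a v) (c' := fun v => b v)
    (by exact_mod_cast ha.1.trans hb.1.symm) fun i => by
      have := congrArg (fun z : ℤ => (z : ℝ)) (congrFun hab i)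
      simpa [F] using this
  ext v
  by_cases hv : v ∈ S
  · exact_mod_cast h v hv
  · rw [Finsupp.notMem_support_iff.mp fun h => hv (ha.2 h),
      Finsupp.notMem_support_iff.mp fun h => hv (hb.2 h)]

/-- If a lattice simplex with `d + 1` vertices has no lattice points in its `j`-th dilates for
`0 < j < d` other than the sums of `j` vertices, then the same holds for its `d`-th dilate. -/
theorem LatticeAffineIndependent.dilatePoints_subset_sumPoints {S : Finset (Fin n → ℤ)}
    (hS : LatticeAffineIndependent S) {d : ℕ} (hd : 2 ≤ d) (hcard : S.card = d + 1)
    (h : ∀ j < d, dilatePoints (latticeHull S) j ⊆ sumPoints S j) :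
    dilatePoints (latticeHull S) d ⊆ sumPoints S d := by
  have hne : S.Nonempty := Finset.card_pos.mp (by lia)
  intro z hz
  obtain ⟨c, h0, h1, hz⟩ := (mem_dilatePoints_latticeHull hne).mp hz
  -- Subtracting integer parts moves `z` to a lattice point `y` of the half-open parallelepiped, at
  -- an integer height `j ≤ d`.
  set a : (Fin n → ℤ) → ℕ := fun v => ⌊c v⌋₊ with ha
  have hfr0 : ∀ v ∈ S, 0 ≤ c v - a v := fun v hv => sub_nonneg.mpr (Nat.floor_le (h0 v hv))
  have hfr1 : ∀ v, c v - a v < 1 := fun v => by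
    linarith [Nat.lt_floor_add_one (c v)]
  have hle : ∑ v ∈ S, a v ≤ d := by
    have := Finset.sum_nonneg hfr0
    rw [Finset.sum_sub_distrib, h1, sub_nonneg] at this
    exact_mod_cast this
  obtain ⟨j, hj⟩ := Nat.exists_eq_add_of_le hle
  have hsum : ∑ v ∈ S, (c v - a v) = j := by
    rw [Finset.sum_sub_distrib, h1, hj]
    push_cast
    ring
  set y : Fin n → ℤ := z - ∑ v ∈ S, a v • v with hy
  have hyi : ∀ i, ∑ v ∈ S, (c v - a v) * (v i : ℝ) = y i := fun i => by
    simp [hy, sub_mul, Finset.sum_sub_distrib, hz]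
  rcases lt_or_ge j d with hjd | hjd
  · obtain ⟨b, hb, hby⟩ := h j hjd ((mem_dilatePoints_latticeHull hne).mpr ⟨_, hfr0, hsum, hyi⟩)
    refine ⟨fun v => a v + b v, by rw [Finset.sum_add_distrib, hb, hj], ?_⟩
    simp only [add_smul, Finset.sum_add_distrib, hby, hy]
    abel
  -- All integer parts vanish. The complementary coefficients `1 - (c v - a v)` sum to `(d + 1) - d
  -- = 1` and are all positive, yet they give a lattice point at height `1`, which must be a single
  -- vertex.
  · exfalso
    have hjd' : j = d := by lia
    have hs1 : ∑ v ∈ S, (1 - (c v - a v)) = ((1 : ℕ) : ℝ) := by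
      rw [Finset.sum_sub_distrib, hsum, hjd', Finset.sum_const, hcard]
      simp
    have hw : ∀ i, ∑ v ∈ S, (1 - (c v - a v)) * (v i : ℝ) = (∑ v ∈ S, v - y) i := fun i => by
      rw [Finset.sum_congr rfl fun v _ => sub_mul 1 (c v - a v) (v i : ℝ), Finset.sum_sub_distrib,
        hyi]
      simp
    obtain ⟨b, hb, hbw⟩ := h 1 (by lia) ((mem_dilatePoints_latticeHull hne).mpr
      ⟨_, fun v _ => (sub_pos.mpr (hfr1 v)).le, hs1, hw⟩)
    have heq := hS.eq_of_sum_eq (c := fun v => 1 - (c v - a v)) (c' := fun v => b v)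
      (by rw [hs1]; exact_mod_cast hb.symm) fun i => by
        rw [hw, ← hbw]
        simp
    have hb1 : ∀ v ∈ S, 1 ≤ b v := fun v hv => by
      have : (0 : ℝ) < b v := by
        rw [← heq v hv]
        exact sub_pos.mpr (hfr1 v)
      exact_mod_cast this
    have := Finset.card_nsmul_le_sum S b 1 hb1
    rw [hb, hcard] at this
    simp at this
    lia

end Polytope

/-! ### `M d` is not an Ehrhart polynomial -/

theorem not_isEhrhart_M {d : ℕ} (hd : d ≠ 1) : ¬ IsEhrhart (M d) := by
  classical
  rintro ⟨n, P, ⟨V, hV, hPV⟩, hP⟩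
  replace hPV : P = latticeHull V := hPV
  have count : ∀ t : ℕ, (dilatePoints P t).ncard = (t + d).choose d + t.choose d := fun t => by
    have := hP t
    rw [eval_M_natCast] at this
    exact_mod_cast this.symm
  have hfin : ∀ t, (dilatePoints P t).Finite := fun t =>
    finite_dilatePoints (hPV ▸ isBounded_latticeHull V) t
  -- For `d = 0` the polynomial is `2`, while the zeroth dilate has only one point.
  rcases Nat.eq_zero_or_pos d with rfl | hdpos
  · have h0 := count 0
    have : dilatePoints P 0 ⊆ {0} := fun z hz => by
      obtain ⟨y, -, hy⟩ := Set.mem_smul_set.mp hz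
      refine latticePoint_injective (hy.symm.trans ?_)
      funext i
      simp [latticePoint]
    have := Set.ncard_le_ncard this
    simp [h0] at this
  obtain ⟨k, rfl⟩ : ∃ k, d = k + 2 := ⟨d - 2, by lia⟩
  set S := (hfin 1).toFinset with hS
  have hcard : S.card = k + 2 + 1 := by
    rw [hS, ← Set.ncard_eq_toFinset_card _ (hfin 1), count, Nat.choose_eq_zero_of_lt (show 1 < k + 2 by lia),
      add_zero, add_comm 1, Nat.choose_succ_self_right]
  have hSP : latticeHull S = P := by
    apply Set.Subset.antisymm
    · refine convexHull_min ?_ (hPV ▸ convex_convexHull ℝ _)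
      rintro _ ⟨v, hv, rfl⟩
      simpa [hS, dilatePoints] using hv
    · rw [hPV]
      refine convexHull_mono (Set.image_mono fun v hv => ?_)
      simp only [hS, Set.Finite.coe_toFinset, dilatePoints, Nat.cast_one, one_smul,
        Set.mem_ofPred_eq, hPV]
      exact subset_convexHull _ _ ⟨v, hv, rfl⟩
  have hne : S.Nonempty := Finset.card_pos.mp (by lia)
  by_cases hind : LatticeAffineIndependent S
  · have small : ∀ j < k + 2, dilatePoints (latticeHull S) j ⊆ sumPoints S j := fun j hj => by
      refine (Set.eq_of_subset_of_ncard_le (sumPoints_subset hne j) ?_ (hSP ▸ hfin j)).ge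
      rw [hind.ncard_sumPoints, hcard, hSP, count, Nat.choose_eq_zero_of_lt hj, add_zero,
        show k + 2 + 1 + j - 1 = j + (k + 2) by lia, ← Nat.choose_symm_add]
    have hle := Set.ncard_le_ncard
      (hind.dilatePoints_subset_sumPoints (by lia) hcard small)
      ((hSP ▸ hfin (k + 2)).subset (sumPoints_subset hne (k + 2)))
    rw [hind.ncard_sumPoints, hcard, hSP, count, Nat.choose_self,
      show k + 2 + 1 + (k + 2) - 1 = k + 2 + (k + 2) by lia] at hle
    lia
  · obtain ⟨N, hN⟩ := exists_ncard_dilatePoints_le_of_not_independent hcard.le hind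
    have hlow : ∀ t : ℕ, (t + 1) ^ (k + 2) ≤ (k + 2)! * (t + (k + 2)).choose (k + 2) := fun t => by
      rw [← Nat.descFactorial_eq_factorial_mul_choose]
      have := (t + (k + 2)).pow_sub_le_descFactorial (k + 2)
      rwa [show t + (k + 2) + 1 - (k + 2) = t + 1 by lia] at this
    -- The bounds would force `t + 1 ≤ (k + 2)! * N`, which fails at this `t`.
    set t := (k + 2)! * N with ht
    have h1 : (t + 1) ^ (k + 2) ≤ t * (t + 1) ^ (k + 1) := by
      calc (t + 1) ^ (k + 2) ≤ (k + 2)! * (t + (k + 2)).choose (k + 2) := hlow t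
        _ ≤ (k + 2)! * (N * (t + 1) ^ (k + 1)) := by
          have := hN t
          rw [hSP, count] at this
          exact Nat.mul_le_mul_left _ ((Nat.le_add_right _ _).trans this)
        _ = t * (t + 1) ^ (k + 1) := by rw [ht, mul_assoc]
    have h2 : 0 < (t + 1) ^ (k + 1) := by positivity
    rw [pow_succ] at h1
    nlinarith

end SNNRoots

theorem mainTheorem1 :
    -- `M_d` is SNN
    (∀ d : ℕ, SNNRoots.IsSNN (SNNRoots.M d)) ∧
    -- `M_d` is not an Ehrhart polynomial, except for `M_1 = 2 t + 1`
    (∀ d : ℕ, d ≠ 1 → ¬ SNNRoots.IsEhrhart (SNNRoots.M d)) ∧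
    -- all roots have real part `-1/2`
    (∀ (d : ℕ) (s : ℂ), (SNNRoots.M d).IsRoot s → s.re = -1 / 2) ∧
    -- the equation `p_d(b) = π / 2` has exactly one real solution, which is nonnegative
    (∀ d : ℕ, 1 ≤ d →
      ∃ b : ℝ, 0 ≤ b ∧ ∀ x : ℝ, SNNRoots.arccotSum d x = Real.pi / 2 ↔ x = b) ∧
    -- the roots of maximal norm are the `-1/2 ± i b` with `p_d(b) = π / 2`
    (∀ d : ℕ, 1 ≤ d → ∀ s : ℂ, SNNRoots.IsMaxNormRoot (SNNRoots.M d) s ↔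
      (s.re = -1 / 2 ∧ SNNRoots.arccotSum d |s.im| = Real.pi / 2)) ∧
    -- growth of the root of maximal norm
    (∀ β : ℕ → ℂ, (∀ d : ℕ, 1 ≤ d → SNNRoots.IsMaxNormRoot (SNNRoots.M d) (β d)) →
      (fun d : ℕ => ‖β d + 1 / 2‖ - (d : ℝ) ^ 2 / Real.pi) =O[atTop]
        (fun _ : ℕ => (1 : ℝ))) := by
  exact ⟨SNNRoots.isSNN_M, fun _ => SNNRoots.not_isEhrhart_M, fun _ _ => SNNRoots.re_of_isRoot_M,
    fun _ => SNNRoots.existsUnique_arccotSum_eq, fun _ => SNNRoots.isMaxNormRoot_M_iff,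
    fun _ => SNNRoots.norm_maxNormRoot_isBigO⟩
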